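/- Let $\mathcal{A}$ be an additive category with a (Quillen) exact structure. Assume that $\mathcal{A}$ is weakly idempotent complete (every split monomorphism has a cokernel) and has enough projectives and enough injectives with respect to the exact structure. For a class $\mathcal{X}$ of objects put $\mathcal{X}^{\perp}=\{Y : \mathrm{Ext}^1_{\mathcal{A}}(X,Y)=0 \text{ for all } X\in\mathcal{X}\}$ and ${}^{\perp}\mathcal{X}=\{Y : \mathrm{Ext}^1_{\mathcal{A}}(Y,X)=0 \text{ for all } X\in\mathcal{X}\}$. For an integer $n\ge 0$ let $\mathcal{X}_n$ be the class of objects $M$ of $\mathcal{X}$-projective dimension at most $n$, i.e. those for which, for some $0\le m\le n$, there is an acyclic sequence $X_m\rightarrowtail X_{m-1}\to\cdots\to X_0\twoheadrightarrow M$ with all $X_i\in\mathcal{X}$. A cotorsion pair is a pair $(\mathcal{X},\mathcal{Y})$ of classes of objects with $\mathcal{X}^{\perp}=\mathcal{Y}$ and ${}^{\perp}\mathcal{Y}=\mathcal{X}$. It is complete if every object $M$ has conflations $Y\rightarrowtail X\twoheadrightarrow M$ and $M\rightarrowtail Y'\twoheadrightarrow X'$ with $X,X'\in\mathcal{X}$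 and $Y,Y'\in\mathcal{Y}$; it is hereditary if $\mathcal{X}$ is closed under kernels of deflations between objects of $\mathcal{X}$ and $\mathcal{Y}$ is closed under cokernels of inflations between objects of $\mathcal{Y}$. A complete cotorsion pair $(\mathcal{X},\mathcal{Y})$ is left extendable if $(\mathcal{X}_n,\mathcal{X}_n^{\perp})$ is a complete cotorsion pair for every $n\ge 0$. A hereditary Hovey triple is a triple $(\mathcal{C},\mathcal{W},\mathcal{F})$ of classes of objects such that $(\mathcal{C}\cap\mathcal{W},\mathcal{F})$ and $(\mathcal{C},\mathcal{W}\cap\mathcal{F})$ are complete hereditary cotorsion pairs and $\mathcal{W}$ is thick, i.e. closed under direct summands and such that, whenever two of the three objects of a conflation lie in $\mathcal{W}$, so does the third. **Theorem.** Let $(\mathcal{C},\mathcal{W},\mathcal{F})$ be a hereditary Hovey triple in $\mathcal{A}$ such that the cotorsion pair $(\mathcal{C}\cap\mathcal{W},\mathcal{F})$ is left extendable. Then, for every object $M$ of $\mathcal{A}$ and every integer $n\ge 0$, the following are equivalent: 1. $M\in\mathcal{C}_n$. 2. There is a conflation $K\rightarrowtail G\twoheadrightarrow M$ with $G\in\mathcal{C}$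 and $K\in(\mathcal{C}\cap\mathcal{W})_{n-1}$ such that the sequence $0\to\mathrm{Hom}_{\mathcal{A}}(M,Y)\to\mathrm{Hom}_{\mathcal{A}}(G,Y)\to\mathrm{Hom}_{\mathcal{A}}(K,Y)\to 0$ is exact for all $Y\in(\mathcal{C}\cap\mathcal{W})_n^{\perp}$, where $(\mathcal{C}\cap\mathcal{W})_{n}^{\perp}=((\mathcal{C}\cap\mathcal{W})_{n})^{\perp}$ and, for $n=0$, $(\mathcal{C}\cap\mathcal{W})_{-1}$ is the class of zero objects. 3. $\mathrm{Ext}^1_{\mathcal{A}}(M,H)=0$ for every $H\in\mathcal{W}\cap(\mathcal{C}\cap\mathcal{W})_n^{\perp}$. 4. There is a conflation $M\rightarrowtail L\twoheadrightarrow N$ with $L\in(\mathcal{C}\cap\mathcal{W})_n$ and $N\in\mathcal{C}$. -/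

import Mathlib

open CategoryTheory CategoryTheory.Limits

universe v u

/-- An additive category is weakly idempotent complete if every split monomorphism has a
cokernel. -/
def WeaklyIdempotentComplete (A : Type u) [Category.{v} A] [Preadditive A] : Prop :=
  ∀ ⦃X Y : A⦄ (f : X ⟶ Y), IsSplitMono f → HasCokernel f

/-- A Quillen exact structure on an additive category: a class of kernel-cokernel pairs
(the conflations), closed under isomorphism, such that identities are inflations and deflations,
inflations and deflations are closed under composition, pushouts of inflations along arbitrary
morphisms exist and are inflations, and dually for pullbacks of deflations. -/
structure ExactStructure (A : Type u) [Category.{v} A] [Preadditive A]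
    [HasFiniteBiproducts A] where
  /-- the class of conflations -/
  conflation : ObjectProperty (ShortComplex A)
  isKernel : ∀ S : ShortComplex A, conflation S →
    Nonempty (IsLimit (KernelFork.ofι S.f S.zero))
  isCokernel : ∀ S : ShortComplex A, conflation S →
    Nonempty (IsColimit (CokernelCofork.ofπ S.g S.zero))
  of_iso : ∀ {S T : ShortComplex A}, (S ≅ T) → conflation S → conflation T
  inflation_id : ∀ X : A, ∃ (Z : A) (g : X ⟶ Z) (w : 𝟙 X ≫ g = 0),
    conflation (ShortComplex.mk (𝟙 X) g w)
  deflation_id : ∀ X : A, ∃ (Z : A) (f : Z ⟶ X) (w : f ≫ 𝟙 X = 0),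
    conflation (ShortComplex.mk f (𝟙 X) w)
  inflation_comp : ∀ {X Y Z : A} (f : X ⟶ Y) (g : Y ⟶ Z),
    (∃ (U : A) (p : Y ⟶ U) (w : f ≫ p = 0), conflation (ShortComplex.mk f p w)) →
    (∃ (U : A) (p : Z ⟶ U) (w : g ≫ p = 0), conflation (ShortComplex.mk g p w)) →
    ∃ (U : A) (p : Z ⟶ U) (w : (f ≫ g) ≫ p = 0), conflation (ShortComplex.mk (f ≫ g) p w)
  deflation_comp : ∀ {X Y Z : A} (f : X ⟶ Y) (g : Y ⟶ Z),
    (∃ (U : A) (i : U ⟶ X) (w : i ≫ f = 0), conflation (ShortComplex.mk i f w)) →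
    (∃ (U : A) (i : U ⟶ Y) (w : i ≫ g = 0), conflation (ShortComplex.mk i g w)) →
    ∃ (U : A) (i : U ⟶ X) (w : i ≫ f ≫ g = 0), conflation (ShortComplex.mk i (f ≫ g) w)
  inflation_pushout : ∀ {X Y Z : A} (f : X ⟶ Y) (a : X ⟶ Z),
    (∃ (U : A) (p : Y ⟶ U) (w : f ≫ p = 0), conflation (ShortComplex.mk f p w)) →
    ∃ (P : A) (b : Y ⟶ P) (f' : Z ⟶ P), IsPushout f a b f' ∧
      ∃ (U : A) (p : P ⟶ U) (w : f' ≫ p = 0), conflation (ShortComplex.mk f' p w)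
  deflation_pullback : ∀ {X Y Z : A} (g : X ⟶ Y) (a : Z ⟶ Y),
    (∃ (U : A) (i : U ⟶ X) (w : i ≫ g = 0), conflation (ShortComplex.mk i g w)) →
    ∃ (P : A) (b : P ⟶ X) (g' : P ⟶ Z), IsPullback b g' g a ∧
      ∃ (U : A) (i : U ⟶ P) (w : i ≫ g' = 0), conflation (ShortComplex.mk i g' w)

namespace ExactStructure

variable {A : Type u} [Category.{v} A] [Preadditive A] [HasFiniteBiproducts A]

/-- Inflations: the first maps of conflations. -/
def Inflation (E : ExactStructure A) {X Y : A} (f : X ⟶ Y) : Prop :=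
  ∃ (Z : A) (g : Y ⟶ Z) (w : f ≫ g = 0), E.conflation (ShortComplex.mk f g w)

/-- Deflations: the second maps of conflations. -/
def Deflation (E : ExactStructure A) {Y Z : A} (g : Y ⟶ Z) : Prop :=
  ∃ (X : A) (f : X ⟶ Y) (w : f ≫ g = 0), E.conflation (ShortComplex.mk f g w)

/-- `P` is projective: morphisms out of `P` lift along deflations. -/
def IsProjective (E : ExactStructure A) (P : A) : Prop :=
  ∀ ⦃Y Z : A⦄ (g : Y ⟶ Z), E.Deflation g → ∀ a : P ⟶ Z, ∃ b : P ⟶ Y, b ≫ g = a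

/-- `I` is injective: morphisms into `I` extend along inflations. -/
def IsInjective (E : ExactStructure A) (I : A) : Prop :=
  ∀ ⦃X Y : A⦄ (f : X ⟶ Y), E.Inflation f → ∀ a : X ⟶ I, ∃ b : Y ⟶ I, f ≫ b = a

/-- Every object is the target of a deflation from a projective object. -/
def EnoughProj (E : ExactStructure A) : Prop :=
  ∀ M : A, ∃ (P : A) (p : P ⟶ M), E.IsProjective P ∧ E.Deflation p

/-- Every object is the source of an inflation into an injective object. -/
def EnoughInj (E : ExactStructure A) : Prop :=
  ∀ M : A, ∃ (I : A) (i : M ⟶ I), E.IsInjective I ∧ E.Inflation i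

/-- An extension of `X` by `Y`: a conflation `Y ↣ mid ↠ X`. -/
structure Extension (E : ExactStructure A) (X Y : A) where
  /-- the middle term -/
  mid : A
  /-- the inflation -/
  i : Y ⟶ mid
  /-- the deflation -/
  p : mid ⟶ X
  w : i ≫ p = 0
  conf : E.conflation (ShortComplex.mk i p w)

/-- Equivalence of extensions: an isomorphism of the middle terms that is compatible with the
identities of the two ends. -/
instance extensionSetoid (E : ExactStructure A) (X Y : A) : Setoid (E.Extension X Y) where
  r S T := ∃ e : S.mid ≅ T.mid, S.i ≫ e.hom = T.i ∧ e.hom ≫ T.p = S.p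
  iseqv :=
    { refl := fun S => ⟨Iso.refl _, by simp, by simp⟩
      symm := by
        rintro S T ⟨e, h1, h2⟩
        exact ⟨e.symm, by simp [← h1], by simp [← h2]⟩
      trans := by
        rintro S T U ⟨e, h1, h2⟩ ⟨e', h1', h2'⟩
        exact ⟨e ≪≫ e', by simp [← Category.assoc, h1, h1'], by simp [h2, h2']⟩ }

/-- The underlying set of the Yoneda group `Ext¹(X, Y)`: equivalence classes of extensions of
`X` by `Y`. -/
def Ext1 (E : ExactStructure A) (X Y : A) : Type (max u v) :=
  Quotient (E.extensionSetoid X Y)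

/-- `Ext¹(X, Y) = 0`: the (never empty) set of classes of extensions has only one element. -/
def Ext1Zero (E : ExactStructure A) (X Y : A) : Prop :=
  Subsingleton (E.Ext1 X Y)

/-- `𝒳^⊥ = {M | Ext¹(X, M) = 0 for all X ∈ 𝒳}`. -/
def rightPerp (E : ExactStructure A) (𝒳 : ObjectProperty A) : ObjectProperty A :=
  fun M => ∀ X : A, 𝒳 X → E.Ext1Zero X M

/-- `^⊥𝒴 = {M | Ext¹(M, Y) = 0 for all Y ∈ 𝒴}`. -/
def leftPerp (E : ExactStructure A) (𝒴 : ObjectProperty A) : ObjectProperty A :=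
  fun M => ∀ Y : A, 𝒴 Y → E.Ext1Zero M Y

/-- `(𝒳, 𝒴)` is a cotorsion pair. -/
structure IsCotorsionPair (E : ExactStructure A) (𝒳 𝒴 : ObjectProperty A) : Prop where
  right_eq : E.rightPerp 𝒳 = 𝒴
  left_eq : E.leftPerp 𝒴 = 𝒳

/-- `(𝒳, 𝒴)` is a complete cotorsion pair: it is a cotorsion pair and every object `M` has
conflations `Y ↣ X ↠ M` and `M ↣ Y' ↠ X'` with `X, X' ∈ 𝒳` and `Y, Y' ∈ 𝒴`. -/
structure IsCompleteCotorsionPair (E : ExactStructure A) (𝒳 𝒴 : ObjectProperty A) : Prop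
    extends E.IsCotorsionPair 𝒳 𝒴 where
  exists_left : ∀ M : A, ∃ (Y X : A) (f : Y ⟶ X) (g : X ⟶ M) (w : f ≫ g = 0),
    E.conflation (ShortComplex.mk f g w) ∧ 𝒳 X ∧ 𝒴 Y
  exists_right : ∀ M : A, ∃ (Y X : A) (f : M ⟶ Y) (g : Y ⟶ X) (w : f ≫ g = 0),
    E.conflation (ShortComplex.mk f g w) ∧ 𝒳 X ∧ 𝒴 Y

/-- Heredity of a pair `(𝒳, 𝒴)`: `𝒳` is closed under kernels of deflations (between objects of
`𝒳`) and `𝒴` is closed under cokernels of inflations (between objects of `𝒴`). -/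
structure IsHereditary (E : ExactStructure A) (𝒳 𝒴 : ObjectProperty A) : Prop where
  kernel_mem : ∀ S : ShortComplex A, E.conflation S → 𝒳 S.X₂ → 𝒳 S.X₃ → 𝒳 S.X₁
  cokernel_mem : ∀ S : ShortComplex A, E.conflation S → 𝒴 S.X₁ → 𝒴 S.X₂ → 𝒴 S.X₃

/-- `𝒲` is thick: closed under direct summands, and if two of the three objects of a conflation
are in `𝒲`, then so is the third. -/
structure IsThick (E : ExactStructure A) (𝒲 : ObjectProperty A) : Prop where
  summand_mem : ∀ (X Y : A) (b : BinaryBicone X Y), Nonempty b.IsBilimit → 𝒲 b.pt → 𝒲 X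
  mem₁ : ∀ S : ShortComplex A, E.conflation S → 𝒲 S.X₂ → 𝒲 S.X₃ → 𝒲 S.X₁
  mem₂ : ∀ S : ShortComplex A, E.conflation S → 𝒲 S.X₁ → 𝒲 S.X₃ → 𝒲 S.X₂
  mem₃ : ∀ S : ShortComplex A, E.conflation S → 𝒲 S.X₁ → 𝒲 S.X₂ → 𝒲 S.X₃

/-- Hovey triples. -/
structure IsHoveyTriple (E : ExactStructure A) (𝒞 𝒲 ℱ : ObjectProperty A) : Prop where
  trivCof_fib : E.IsCompleteCotorsionPair (𝒞 ⊓ 𝒲) ℱ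
  cof_trivFib : E.IsCompleteCotorsionPair 𝒞 (𝒲 ⊓ ℱ)
  thick : E.IsThick 𝒲

/-- Hereditary Hovey triples. -/
structure IsHereditaryHoveyTriple (E : ExactStructure A) (𝒞 𝒲 ℱ : ObjectProperty A) : Prop
    extends E.IsHoveyTriple 𝒞 𝒲 ℱ where
  hereditary_trivCof_fib : E.IsHereditary (𝒞 ⊓ 𝒲) ℱ
  hereditary_cof_trivFib : E.IsHereditary 𝒞 (𝒲 ⊓ ℱ)

/-- There is an acyclic sequence `X_n ↣ X_{n-1} → ⋯ → X_0 ↠ M` with all `X_i ∈ 𝒳`, that is,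
a sequence spliced from conflations `K_{i+1} ↣ X_i ↠ K_i` (`i < n`) with `K_0 = M` and
`K_n ≅ X_n`. For `n = 0` this is an isomorphism `X_0 ≅ M`. -/
def HasResolution (E : ExactStructure A) (𝒳 : ObjectProperty A) : ℕ → A → Prop
  | 0, M => ∃ X : A, 𝒳 X ∧ Nonempty (X ≅ M)
  | n + 1, M => ∃ (K X : A) (f : K ⟶ X) (g : X ⟶ M) (w : f ≫ g = 0),
      E.conflation (ShortComplex.mk f g w) ∧ 𝒳 X ∧ HasResolution E 𝒳 n K

/-- The `𝒳`-projective dimension: the least length of an acyclic sequence as above, and `∞` if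
there is none. -/
noncomputable def projDim (E : ExactStructure A) (𝒳 : ObjectProperty A) (M : A) : ℕ∞ :=
  ⨅ (n : ℕ) (_ : E.HasResolution 𝒳 n M), (n : ℕ∞)

/-- The class `𝒳_n` of the objects of `𝒳`-projective dimension at most `n`. -/
def dimLE (E : ExactStructure A) (𝒳 : ObjectProperty A) (n : ℕ) : ObjectProperty A :=
  fun M => E.projDim 𝒳 M ≤ n

/-- The class `𝒳_{n-1}`, which for `n = 0` consists of the zero objects. -/
def dimLEPred (E : ExactStructure A) (𝒳 : ObjectProperty A) : ℕ → ObjectProperty A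
  | 0 => fun M => IsZero M
  | n + 1 => E.dimLE 𝒳 n

/-- The complete cotorsion pair `(𝒳, 𝒴)` is left extendable: `(𝒳_n, 𝒳_n^⊥)` is a complete
cotorsion pair for every `n`. -/
structure IsLeftExtendable (E : ExactStructure A) (𝒳 𝒴 : ObjectProperty A) : Prop where
  complete : E.IsCompleteCotorsionPair 𝒳 𝒴
  extend : ∀ n : ℕ, E.IsCompleteCotorsionPair (E.dimLE 𝒳 n) (E.rightPerp (E.dimLE 𝒳 n))

/-- The sequence `0 → Hom(S.X₃, Y) → Hom(S.X₂, Y) → Hom(S.X₁, Y) → 0` is exact. -/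
def HomExact (S : ShortComplex A) (Y : A) : Prop :=
  Function.Injective (Preadditive.leftComp Y S.g) ∧
  Function.Exact (Preadditive.leftComp Y S.g) (Preadditive.leftComp Y S.f) ∧
  Function.Surjective (Preadditive.leftComp Y S.f)

end ExactStructure

/-! The implications are proved in the cycle 1 → 4 → 2 → 3 → 1. Write 𝒳 = 𝒞 ∩ 𝒲. 1 → 4
(`exists_conflation_of_hasResolution`): a cofibrant resolution is replaced, one syzygy at a time, by
an 𝒳-resolution of the same length; two pushouts per stage keep the cokernel cofibrant. 4 → 2: a
deflation X ↠ L with X in 𝒳 is pulled back along M ↣ L. Heredity makes the pullback cofibrant, and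
Ext¹(L, Y) = 0 extends maps K ⟶ Y to X, hence to G. 2 → 3: the Hom-exactness and Ext¹(G, H) = 0 give
Ext¹(M, H) = 0. 3 → 1 (`dimLE_of_ext1Zero`): dimension shifting. A syzygy of M is tested on H by
testing M on a cosyzygy of H, which lies in the next class by `rightPerp_dimLE_succ`. Only Ext¹ is
available, so lifting and extension of morphisms take the place of long exact sequences. -/

namespace ExactStructure

variable {A : Type u} [Category.{v} A] [Preadditive A] [HasFiniteBiproducts A]
  {E : ExactStructure A}

/-! ### Conflations: pushouts, pullbacks and splittings. -/

section Basic

variable {X Y Z : A} {f : X ⟶ Y} {g : Y ⟶ Z} {w : f ≫ g = 0}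

lemma mono_of_conflation (h : E.conflation (ShortComplex.mk f g w)) : Mono f := by
  obtain ⟨hl⟩ := E.isKernel _ h
  exact mono_of_isLimit_fork hl

lemma epi_of_conflation (h : E.conflation (ShortComplex.mk f g w)) : Epi g := by
  obtain ⟨hl⟩ := E.isCokernel _ h
  exact epi_of_isColimit_cofork hl

lemma exists_lift_of_conflation (h : E.conflation (ShortComplex.mk f g w)) {T : A}
    (k : T ⟶ Y) (hk : k ≫ g = 0) : ∃ l : T ⟶ X, l ≫ f = k := by
  obtain ⟨hl⟩ := E.isKernel _ h
  obtain ⟨l, hl'⟩ := KernelFork.IsLimit.lift' hl k hk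
  exact ⟨l, hl'⟩

lemma exists_desc_of_conflation (h : E.conflation (ShortComplex.mk f g w)) {T : A}
    (k : Y ⟶ T) (hk : f ≫ k = 0) : ∃ l : Z ⟶ T, g ≫ l = k := by
  obtain ⟨hl⟩ := E.isCokernel _ h
  obtain ⟨l, hl'⟩ := CokernelCofork.IsColimit.desc' hl k hk
  exact ⟨l, hl'⟩

lemma conflation_of_iso {X' Y' Z' : A} {f' : X' ⟶ Y'} {g' : Y' ⟶ Z'} {w' : f' ≫ g' = 0}
    (h : E.conflation (ShortComplex.mk f g w)) (a : X ≅ X') (b : Y ≅ Y') (c : Z ≅ Z')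
    (hf : a.hom ≫ f' = f ≫ b.hom) (hg : b.hom ≫ g' = g ≫ c.hom) :
    E.conflation (ShortComplex.mk f' g' w') :=
  E.of_iso (ShortComplex.isoMk a b c hf hg) h

/-- An inflation and any cokernel of it form a conflation. -/
lemma Inflation.conflation_of_cokernel (hf : E.Inflation f) [Epi g]
    (hg : ∀ ⦃T : A⦄ (k : Y ⟶ T), f ≫ k = 0 → ∃ l : Z ⟶ T, g ≫ l = k) :
    E.conflation (ShortComplex.mk f g w) := by
  obtain ⟨U, p, wp, hp⟩ := hf
  have := epi_of_conflation hp
  obtain ⟨a, ha⟩ := exists_desc_of_conflation hp g w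
  obtain ⟨b, hb⟩ := hg p wp
  have hab : a ≫ b = 𝟙 _ := by
    rw [← cancel_epi p, ← Category.assoc, ha, hb, Category.comp_id]
  have hba : b ≫ a = 𝟙 _ := by
    rw [← cancel_epi g, ← Category.assoc, hb, ha, Category.comp_id]
  exact conflation_of_iso hp (Iso.refl _) (Iso.refl _) ⟨a, b, hab, hba⟩
    (by simp) (by simp [ha])

/-- A deflation and any kernel of it form a conflation. -/
lemma Deflation.conflation_of_kernel (hg : E.Deflation g) [Mono f]
    (hf : ∀ ⦃T : A⦄ (k : T ⟶ Y), k ≫ g = 0 → ∃ l : T ⟶ X, l ≫ f = k) :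
    E.conflation (ShortComplex.mk f g w) := by
  obtain ⟨U, i, wi, hi⟩ := hg
  have := mono_of_conflation hi
  obtain ⟨a, ha⟩ := exists_lift_of_conflation hi f w
  obtain ⟨b, hb⟩ := hf i wi
  have hab : a ≫ b = 𝟙 _ := by
    rw [← cancel_mono f, Category.assoc, hb, ha, Category.id_comp]
  have hba : b ≫ a = 𝟙 _ := by
    rw [← cancel_mono i, Category.assoc, ha, hb, Category.id_comp]
  exact conflation_of_iso hi ⟨b, a, hba, hab⟩ (Iso.refl _) (Iso.refl _)
    (by simp [hb]) (by simp)

/-- The pushout of a conflation along a morphism out of its first object. -/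
lemma conflation_pushout (h : E.conflation (ShortComplex.mk f g w)) {V P : A} {a : X ⟶ V}
    {b : Y ⟶ P} {f' : V ⟶ P} (sq : IsPushout f a b f') :
    ∃ (g' : P ⟶ Z) (w' : f' ≫ g' = 0),
      E.conflation (ShortComplex.mk f' g' w') ∧ b ≫ g' = g := by
  have := epi_of_conflation h
  have hf' : E.Inflation f' := by
    obtain ⟨P₀, b₀, f₀, sq₀, U, p, wp, hp⟩ := E.inflation_pushout f a ⟨_, _, _, h⟩
    refine ⟨U, (sq₀.isoIsPushout _ _ sq).inv ≫ p, ?_, conflation_of_iso hp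
      (Iso.refl _) (sq₀.isoIsPushout _ _ sq) (Iso.refl _) ?_ ?_⟩
    · rw [← Category.assoc, sq₀.inr_isoIsPushout_inv, wp]
    · simp
    · simp
  have hb : b ≫ sq.desc g 0 (by simp [w]) = g := by simp
  have : Epi (sq.desc g (0 : V ⟶ Z) (by simp [w])) := by
    rw [← hb] at this
    exact epi_of_epi b _
  refine ⟨sq.desc g 0 _, sq.inr_desc _ _ _, hf'.conflation_of_cokernel ?_, hb⟩
  intro T k hk
  obtain ⟨l, hl⟩ := exists_desc_of_conflation h (b ≫ k) (by
    rw [← Category.assoc, sq.w, Category.assoc, hk, comp_zero])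
  exact ⟨l, sq.hom_ext (by simp [hl]) (by simp [hk])⟩

/-- The pullback of a conflation along a morphism into its last object. -/
lemma conflation_pullback (h : E.conflation (ShortComplex.mk f g w)) {V P : A} {a : V ⟶ Z}
    {b : P ⟶ Y} {g' : P ⟶ V} (sq : IsPullback b g' g a) :
    ∃ (f' : X ⟶ P) (w' : f' ≫ g' = 0),
      E.conflation (ShortComplex.mk f' g' w') ∧ f' ≫ b = f := by
  have := mono_of_conflation h
  have hg' : E.Deflation g' := by
    obtain ⟨P₀, b₀, g₀, sq₀, U, i, wi, hi⟩ := E.deflation_pullback g a ⟨_, _, _, h⟩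
    refine ⟨U, i ≫ (sq₀.isoIsPullback _ _ sq).hom, by simp [wi], conflation_of_iso hi
      (Iso.refl _) (sq₀.isoIsPullback _ _ sq) (Iso.refl _) ?_ ?_⟩
    · simp
    · simp
  have hb : sq.lift f 0 (by simp [w]) ≫ b = f := by simp
  have : Mono (sq.lift f (0 : X ⟶ V) (by simp [w])) := by
    rw [← hb] at this
    exact mono_of_mono _ b
  refine ⟨sq.lift f 0 _, sq.lift_snd _ _ _, hg'.conflation_of_kernel ?_, hb⟩
  intro T k hk
  obtain ⟨l, hl⟩ := exists_lift_of_conflation h (k ≫ b) (by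
    rw [Category.assoc, sq.w, ← Category.assoc, hk, zero_comp])
  exact ⟨l, sq.hom_ext (by simp [hl]) (by simp [hk])⟩

/-- A conflation whose deflation has a section is split. -/
lemma nonempty_splitting_of_section (h : E.conflation (ShortComplex.mk f g w)) (s : Z ⟶ Y)
    (hs : s ≫ g = 𝟙 Z) : Nonempty (ShortComplex.mk f g w).Splitting := by
  have := mono_of_conflation h
  obtain ⟨r, hr⟩ := exists_lift_of_conflation h (𝟙 Y - g ≫ s) (by simp [hs])
  exact ⟨{ r := r
           s := s
           f_r := by
            rw [← cancel_mono f]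
            simp [hr, reassoc_of% w]
           s_g := hs
           id := by simp [hr] }⟩

end Basic

/-! ### Vanishing of Ext¹ through sections, lifts and extensions. -/

lemma exists_zero_conflation (E : ExactStructure A) (X : A) :
    ∃ (Z : A) (f : Z ⟶ X) (w : f ≫ 𝟙 X = 0), E.conflation (ShortComplex.mk f (𝟙 X) w) ∧
      IsZero Z := by
  obtain ⟨Z, f, w, h⟩ := E.deflation_id X
  have := mono_of_conflation h
  refine ⟨Z, f, w, h, ?_⟩
  rw [Category.comp_id] at w
  rw [IsZero.iff_id_eq_zero, ← cancel_mono f]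
  simp [w]

/-- Push the conflation 0 ↣ X ↠ X out along 0 ⟶ Y; the leg starting at X is the section. -/
lemma exists_split_conflation (E : ExactStructure A) (X Y : A) :
    ∃ (P : A) (i : Y ⟶ P) (p : P ⟶ X) (w : i ≫ p = 0),
      E.conflation (ShortComplex.mk i p w) ∧ ∃ s : X ⟶ P, s ≫ p = 𝟙 X := by
  obtain ⟨Z, f, w, h, -⟩ := E.exists_zero_conflation X
  obtain ⟨P, b, f', sq, -⟩ := E.inflation_pushout f (0 : Z ⟶ Y) ⟨_, _, _, h⟩
  obtain ⟨g', w', h', hb⟩ := conflation_pushout h sq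
  exact ⟨P, f', g', w', h', b, hb⟩

/-- `Ext¹(X, Y) = 0` if and only if all extensions of `X` by `Y` split. -/
lemma ext1Zero_iff {X Y : A} : E.Ext1Zero X Y ↔
    ∀ (P : A) (i : Y ⟶ P) (p : P ⟶ X) (w : i ≫ p = 0),
      E.conflation (ShortComplex.mk i p w) → ∃ s : X ⟶ P, s ≫ p = 𝟙 X := by
  constructor
  · intro hz P i p w h
    obtain ⟨P', i', p', w', h', s, hs⟩ := E.exists_split_conflation X Y
    have := hz.elim (Quotient.mk _ (⟨P', i', p', w', h'⟩ : E.Extension X Y))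
      (Quotient.mk _ ⟨P, i, p, w, h⟩)
    obtain ⟨e, -, he⟩ := Quotient.exact this
    exact ⟨s ≫ e.hom, by rw [Category.assoc]; exact (congrArg (s ≫ ·) he).trans hs⟩
  · intro H
    refine ⟨fun x y => ?_⟩
    induction x using Quotient.inductionOn with | _ S
    induction y using Quotient.inductionOn with | _ T
    obtain ⟨P, i, p, w, h⟩ := S
    obtain ⟨P', i', p', w', h'⟩ := T
    obtain ⟨s, hs⟩ := H _ _ _ _ h
    obtain ⟨s', hs'⟩ := H _ _ _ _ h'
    obtain ⟨σ⟩ := nonempty_splitting_of_section h s hs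
    obtain ⟨τ⟩ := nonempty_splitting_of_section h' s' hs'
    have σ₁ := σ.f_r; have σ₂ := σ.s_g; have σ₃ := σ.id; have σ₄ := σ.s_r
    have τ₁ := τ.f_r; have τ₂ := τ.s_g; have τ₃ := τ.id; have τ₄ := τ.s_r
    dsimp only at σ₁ σ₂ σ₃ σ₄ τ₁ τ₂ τ₃ τ₄
    -- Both middle terms are Y ⊕ X through their splittings; this matches the summands.
    refine Quotient.sound ⟨⟨σ.r ≫ i' + p ≫ τ.s, τ.r ≫ i + p' ≫ σ.s, ?_, ?_⟩, ?_, ?_⟩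
    · simp [reassoc_of% τ₁, reassoc_of% τ₂, reassoc_of% τ₄, reassoc_of% w', σ₃]
    · simp [reassoc_of% σ₁, reassoc_of% σ₂, reassoc_of% σ₄, reassoc_of% w, τ₃]
    · simp [reassoc_of% σ₁, reassoc_of% w]
    · simp [w', τ₂]

section Ext1Zero

variable {K G M : A} {f : K ⟶ G} {g : G ⟶ M} {w : f ≫ g = 0}

lemma Ext1Zero.exists_lift {X : A} (hz : E.Ext1Zero X K)
    (h : E.conflation (ShortComplex.mk f g w)) (a : X ⟶ M) : ∃ b : X ⟶ G, b ≫ g = a := by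
  obtain ⟨P, b, g', sq, -⟩ := E.deflation_pullback g a ⟨_, _, _, h⟩
  obtain ⟨f', w', h', -⟩ := conflation_pullback h sq
  obtain ⟨s, hs⟩ := ext1Zero_iff.1 hz _ _ _ _ h'
  exact ⟨s ≫ b, by rw [Category.assoc, sq.w, ← Category.assoc, hs, Category.id_comp]⟩

lemma Ext1Zero.exists_extend {Y : A} (hz : E.Ext1Zero M Y)
    (h : E.conflation (ShortComplex.mk f g w)) (a : K ⟶ Y) : ∃ b : G ⟶ Y, f ≫ b = a := by
  obtain ⟨P, b, f', sq, -⟩ := E.inflation_pushout f a ⟨_, _, _, h⟩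
  obtain ⟨g', w', h', -⟩ := conflation_pushout h sq
  obtain ⟨s, hs⟩ := ext1Zero_iff.1 hz _ _ _ _ h'
  obtain ⟨σ⟩ := nonempty_splitting_of_section h' s hs
  have hr : f' ≫ σ.r = 𝟙 Y := σ.f_r
  exact ⟨b ≫ σ.r, by rw [← Category.assoc, sq.w, Category.assoc, hr, Category.comp_id]⟩

/-- If `Ext¹(G, Y) = 0` and all morphisms `K ⟶ Y` extend to `G`, then `Ext¹(M, Y) = 0`. -/
lemma ext1Zero_of_extend (h : E.conflation (ShortComplex.mk f g w)) {Y : A}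
    (hG : E.Ext1Zero G Y) (H : ∀ a : K ⟶ Y, ∃ b : G ⟶ Y, f ≫ b = a) : E.Ext1Zero M Y := by
  have := epi_of_conflation h
  rw [ext1Zero_iff]
  intro P i p wp hp
  -- The lift `c` of `g` descends to a section once its restriction to K, which lands in Y, is
  -- removed by extending it to G.
  obtain ⟨c, hc⟩ := hG.exists_lift hp g
  obtain ⟨a, ha⟩ := exists_lift_of_conflation hp (f ≫ c) (by simp [hc, w])
  obtain ⟨b, hb⟩ := H a
  obtain ⟨s, hs⟩ := exists_desc_of_conflation h (c - b ≫ i) (by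
    simp [← ha, reassoc_of% hb])
  refine ⟨s, ?_⟩
  rw [← cancel_epi g]
  simp [reassoc_of% hs, hc, wp]

/-- If `Ext¹(X, G) = 0` and all morphisms `X ⟶ M` lift to `G`, then `Ext¹(X, K) = 0`. -/
lemma ext1Zero_of_lift (h : E.conflation (ShortComplex.mk f g w)) {X : A}
    (hG : E.Ext1Zero X G) (H : ∀ a : X ⟶ M, ∃ b : X ⟶ G, b ≫ g = a) : E.Ext1Zero X K := by
  have := mono_of_conflation h
  rw [ext1Zero_iff]
  intro P i p wp hp
  have := mono_of_conflation hp
  have := epi_of_conflation hp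
  obtain ⟨c, hc⟩ := hG.exists_extend hp f
  obtain ⟨a, ha⟩ := exists_desc_of_conflation hp (c ≫ g) (by simp [reassoc_of% hc, w])
  obtain ⟨b, hb⟩ := H a
  obtain ⟨r, hr⟩ := exists_lift_of_conflation h (c - p ≫ b) (by simp [hb, ha])
  have hir : i ≫ r = 𝟙 K := by
    rw [← cancel_mono f]
    simp [hr, hc, reassoc_of% wp]
  obtain ⟨s, hs⟩ := exists_desc_of_conflation hp (𝟙 P - r ≫ i) (by simp [reassoc_of% hir])
  refine ⟨s, ?_⟩
  rw [← cancel_epi p]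
  simp [reassoc_of% hs, wp]

lemma ext1Zero_of_isInjective {X I : A} (hI : E.IsInjective I) : E.Ext1Zero X I := by
  rw [ext1Zero_iff]
  intro P i p w h
  obtain ⟨r, hr⟩ := hI i ⟨_, _, _, h⟩ (𝟙 I)
  have := epi_of_conflation h
  obtain ⟨s, hs⟩ := exists_desc_of_conflation h (𝟙 P - r ≫ i) (by simp [reassoc_of% hr])
  refine ⟨s, ?_⟩
  rw [← cancel_epi p]
  simp [reassoc_of% hs, w]

lemma ext1Zero_of_isZero {X Y : A} (hX : IsZero X) : E.Ext1Zero X Y :=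
  ext1Zero_iff.2 fun _ _ _ _ _ => ⟨0, hX.eq_of_src _ _⟩

lemma Ext1Zero.of_iso {X X' Y : A} (hz : E.Ext1Zero X Y) (e : X ≅ X') : E.Ext1Zero X' Y := by
  rw [ext1Zero_iff]
  intro P i p w h
  obtain ⟨s, hs⟩ := hz.exists_lift h e.hom
  exact ⟨e.inv ≫ s, by simp [hs]⟩

/-- Embed Y in an injective I with cokernel Y'; it suffices to lift each map G ⟶ Y' to I. Its
restriction to K lifts, and that lift extends to G by injectivity; the remaining error factors
through M, where it lifts too. -/
lemma Ext1Zero.of_extension (hinj : E.EnoughInj) (h : E.conflation (ShortComplex.mk f g w))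
    {Y : A} (hK : E.Ext1Zero K Y) (hM : E.Ext1Zero M Y) : E.Ext1Zero G Y := by
  obtain ⟨I, i, hI, Y', q, wq, hq⟩ := hinj Y
  refine ext1Zero_of_lift hq (ext1Zero_of_isInjective hI) fun c => ?_
  obtain ⟨a, ha⟩ := hK.exists_lift hq (f ≫ c)
  obtain ⟨b, hb⟩ := hI f ⟨_, _, _, h⟩ a
  obtain ⟨d, hd⟩ := exists_desc_of_conflation h (c - b ≫ q) (by
    simp [reassoc_of% hb, ha])
  obtain ⟨d', hd'⟩ := hM.exists_lift hq d
  exact ⟨b + g ≫ d', by simp [hd', hd]⟩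

end Ext1Zero

/-! ### Cotorsion pairs and resolution dimension. -/

section Resolution

variable {𝒳 𝒴 : ObjectProperty A}

lemma dimLE_iff {n : ℕ} {M : A} : E.dimLE 𝒳 n M ↔ ∃ m ≤ n, E.HasResolution 𝒳 m M := by
  constructor
  · intro h
    by_contra! H
    -- If every resolution is longer than n, the infimum is at least n + 1; this covers the value ∞
    -- as well.
    have h1 : ((n + 1 : ℕ) : ℕ∞) ≤ E.projDim 𝒳 M := by
      refine le_iInf₂ fun m hm => ?_
      have : ¬ m ≤ n := fun hmn => H m hmn hm
      exact_mod_cast (by omega : n + 1 ≤ m)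
    have h2 : ((n + 1 : ℕ) : ℕ∞) ≤ n := h1.trans h
    have h3 : n + 1 ≤ n := by exact_mod_cast h2
    omega
  · rintro ⟨m, hmn, hm⟩
    exact (iInf₂_le m hm).trans (by exact_mod_cast hmn)

lemma dimLE_mono {m n : ℕ} (hmn : m ≤ n) {M : A} (h : E.dimLE 𝒳 m M) : E.dimLE 𝒳 n M := by
  obtain ⟨k, hk, h⟩ := dimLE_iff.1 h
  exact dimLE_iff.2 ⟨k, hk.trans hmn, h⟩

lemma dimLE_of_mem (n : ℕ) {M : A} (h : 𝒳 M) : E.dimLE 𝒳 n M :=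
  dimLE_iff.2 ⟨0, n.zero_le, M, h, ⟨Iso.refl _⟩⟩

lemma dimLE_succ {n : ℕ} {K X M : A} {f : K ⟶ X} {g : X ⟶ M} {w : f ≫ g = 0}
    (h : E.conflation (ShortComplex.mk f g w)) (hX : 𝒳 X) (hK : E.dimLE 𝒳 n K) :
    E.dimLE 𝒳 (n + 1) M := by
  obtain ⟨m, hm, hK⟩ := dimLE_iff.1 hK
  exact dimLE_iff.2 ⟨m + 1, by omega, K, X, f, g, w, h, hX, hK⟩

lemma IsCotorsionPair.left_mem (h : E.IsCotorsionPair 𝒳 𝒴) {X : A}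
    (hX : ∀ Y, 𝒴 Y → E.Ext1Zero X Y) : 𝒳 X := by
  rw [← h.left_eq]; exact hX

lemma IsCotorsionPair.right_mem (h : E.IsCotorsionPair 𝒳 𝒴) {Y : A}
    (hY : ∀ X, 𝒳 X → E.Ext1Zero X Y) : 𝒴 Y := by
  rw [← h.right_eq]; exact hY

lemma IsCotorsionPair.ext1Zero (h : E.IsCotorsionPair 𝒳 𝒴) {X Y : A} (hX : 𝒳 X) (hY : 𝒴 Y) :
    E.Ext1Zero X Y := by
  rw [← h.right_eq] at hY; exact hY X hX

lemma IsCotorsionPair.left_of_iso (h : E.IsCotorsionPair 𝒳 𝒴) {X X' : A} (e : X ≅ X')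
    (hX : 𝒳 X) : 𝒳 X' :=
  h.left_mem fun _ hY => (h.ext1Zero hX hY).of_iso e

lemma IsCotorsionPair.left_of_isZero (h : E.IsCotorsionPair 𝒳 𝒴) {X : A} (hX : IsZero X) :
    𝒳 X :=
  h.left_mem fun _ _ => ext1Zero_of_isZero hX

lemma IsCotorsionPair.left_of_extension (h : E.IsCotorsionPair 𝒳 𝒴) (hinj : E.EnoughInj)
    {K G M : A} {f : K ⟶ G} {g : G ⟶ M} {w : f ≫ g = 0}
    (hc : E.conflation (ShortComplex.mk f g w)) (hK : 𝒳 K) (hM : 𝒳 M) : 𝒳 G :=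
  h.left_mem fun _ hY => (h.ext1Zero hK hY).of_extension hinj hc (h.ext1Zero hM hY)

/-- The left class of a cotorsion pair is the class of objects of dimension zero. -/
lemma IsCotorsionPair.dimLE_zero_iff (h : E.IsCotorsionPair 𝒳 𝒴) {M : A} :
    E.dimLE 𝒳 0 M ↔ 𝒳 M := by
  refine ⟨fun hM => ?_, dimLE_of_mem 0⟩
  obtain ⟨m, hm, hM⟩ := dimLE_iff.1 hM
  obtain rfl : m = 0 := by omega
  obtain ⟨X, hX, ⟨e⟩⟩ := hM
  exact h.left_of_iso e hX

/-- An object of dimension at most `n` is the quotient of an object of `𝒳` by one of dimension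
at most `n - 1`. -/
lemma IsCotorsionPair.exists_conflation_of_dimLE (h : E.IsCotorsionPair 𝒳 𝒴) {n : ℕ} {M : A}
    (hM : E.dimLE 𝒳 n M) : ∃ (K X : A) (f : K ⟶ X) (g : X ⟶ M) (w : f ≫ g = 0),
      E.conflation (ShortComplex.mk f g w) ∧ 𝒳 X ∧ E.dimLEPred 𝒳 n K := by
  obtain ⟨m, hm, hres⟩ := dimLE_iff.1 hM
  cases m with
  | zero =>
    obtain ⟨X, hX, ⟨e⟩⟩ := hres
    obtain ⟨Z, f, w, hc, hZ⟩ := E.exists_zero_conflation M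
    refine ⟨Z, M, f, 𝟙 M, w, hc, h.left_of_iso e hX, ?_⟩
    cases n with
    | zero => exact hZ
    | succ n => exact dimLE_of_mem n (h.left_of_isZero hZ)
  | succ m =>
    obtain ⟨n, rfl⟩ : ∃ k, n = k + 1 := ⟨n - 1, by omega⟩
    obtain ⟨K, X, f, g, w, hc, hX, hK⟩ := hres
    exact ⟨K, X, f, g, w, hc, hX, dimLE_iff.2 ⟨m, by omega, hK⟩⟩

lemma IsCotorsionPair.rightPerp_dimLE_le (h : E.IsCotorsionPair 𝒳 𝒴) (n : ℕ) {Y : A}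
    (hY : E.rightPerp (E.dimLE 𝒳 n) Y) : 𝒴 Y :=
  h.right_mem fun X hX => hY X (dimLE_of_mem n hX)

/-- Cosyzygies of objects of `(𝒳_n)^⊥` belong to `(𝒳_{n+1})^⊥`. -/
lemma IsCotorsionPair.rightPerp_dimLE_succ (h : E.IsCotorsionPair 𝒳 𝒴)
    (hher : E.IsHereditary 𝒳 𝒴) {n : ℕ} {H I H' : A} {i : H ⟶ I} {q : I ⟶ H'} {w : i ≫ q = 0}
    (hc : E.conflation (ShortComplex.mk i q w)) (hI : E.IsInjective I)
    (hH : E.rightPerp (E.dimLE 𝒳 n) H) : E.rightPerp (E.dimLE 𝒳 (n + 1)) H' := by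
  intro X hX
  obtain ⟨K, X₀, f, g, wf, hf, hX₀, hK⟩ := h.exists_conflation_of_dimLE hX
  have hIY : 𝒴 I := h.right_mem fun _ _ => ext1Zero_of_isInjective hI
  have hH'Y : 𝒴 H' := hher.cokernel_mem _ hc (h.rightPerp_dimLE_le n hH) hIY
  refine ext1Zero_of_extend hf (h.ext1Zero hX₀ hH'Y) fun a => ?_
  -- K has dimension at most n, so `a` lifts to I; injectivity of I then carries the lift over to
  -- X₀.
  obtain ⟨b, hb⟩ := Ext1Zero.exists_lift (hH K hK) hc a
  obtain ⟨c, hc'⟩ := hI f ⟨_, _, _, hf⟩ b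
  exact ⟨c ≫ q, by rw [← Category.assoc, hc', hb]⟩

/-- A conflation remains exact under `Hom(-, Y)` as soon as morphisms to `Y` extend along its
inflation. -/
lemma homExact_of_extend {K G M : A} {f : K ⟶ G} {g : G ⟶ M} {w : f ≫ g = 0}
    (hc : E.conflation (ShortComplex.mk f g w)) {Y : A}
    (H : ∀ a : K ⟶ Y, ∃ b : G ⟶ Y, f ≫ b = a) :
    HomExact (ShortComplex.mk f g w) Y := by
  have := epi_of_conflation hc
  refine ⟨fun a b hab => (cancel_epi g).1 hab, fun a => ⟨fun ha => ?_, ?_⟩, H⟩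
  · exact exists_desc_of_conflation hc a ha
  · rintro ⟨b, rfl⟩
    change f ≫ g ≫ b = 0
    rw [reassoc_of% w, zero_comp]

end Resolution

/-! ### Dimension arguments for Hovey triples. -/

section Hovey

variable {𝒞 𝒲 ℱ : ObjectProperty A}

/-- Cofibrant objects embed into trivially cofibrant ones with cofibrant cokernel. -/
lemma IsHoveyTriple.exists_conflation_of_cofibrant (hM : E.IsHoveyTriple 𝒞 𝒲 ℱ)
    (hinj : E.EnoughInj) {M : A} (h : 𝒞 M) :
    ∃ (L N : A) (f : M ⟶ L) (g : L ⟶ N) (w : f ≫ g = 0),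
      E.conflation (ShortComplex.mk f g w) ∧ (𝒞 ⊓ 𝒲) L ∧ 𝒞 N := by
  obtain ⟨L, N, f, g, w, hc, hN, hL⟩ := hM.cof_trivFib.exists_right M
  exact ⟨L, N, f, g, w, hc, ⟨hM.cof_trivFib.left_of_extension hinj hc h hN, hL.1⟩, hN⟩

/-- Objects with a finite cofibrant resolution embed, with cofibrant cokernel, into objects with
a trivially cofibrant resolution of the same length. -/
lemma IsHoveyTriple.exists_conflation_of_hasResolution (hM : E.IsHoveyTriple 𝒞 𝒲 ℱ)
    (hinj : E.EnoughInj) {n : ℕ} {M : A} (h : E.HasResolution 𝒞 n M) :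
    ∃ (L N : A) (f : M ⟶ L) (g : L ⟶ N) (w : f ≫ g = 0),
      E.conflation (ShortComplex.mk f g w) ∧ E.dimLE (𝒞 ⊓ 𝒲) n L ∧ 𝒞 N := by
  induction n generalizing M with
  | zero =>
    obtain ⟨X, hX, ⟨e⟩⟩ := h
    obtain ⟨L, N, f, g, w, hc, hL, hN⟩ := hM.exists_conflation_of_cofibrant hinj
      (hM.cof_trivFib.left_of_iso e hX)
    exact ⟨L, N, f, g, w, hc, dimLE_of_mem 0 hL, hN⟩
  | succ n ih =>
    obtain ⟨K, G, f, g, w, hc, hG, hK⟩ := h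
    obtain ⟨L, N, i, p, wi, hi, hL, hN⟩ := ih hK
    obtain ⟨P, b, f', sq, -⟩ := E.inflation_pushout f i ⟨_, _, _, hc⟩
    obtain ⟨g', w', hc', -⟩ := conflation_pushout hc sq
    obtain ⟨p', wp', hp', -⟩ := conflation_pushout hi sq.flip
    -- P sits in both G ↣ P ↠ N and L ↣ P ↠ M; the former makes it cofibrant.
    have hP : 𝒞 P := hM.cof_trivFib.left_of_extension hinj hp' hG hN
    obtain ⟨X, N', j, q, wj, hj, hX, hN'⟩ := hM.exists_conflation_of_cofibrant hinj hP
    -- Q is the required target of M: M ↣ Q inherits the cofibrant cokernel N' of P ↣ X, while X ↠ Q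
    -- has kernel L and so lengthens the resolution of L by one.
    obtain ⟨Q, c, j', sq', -⟩ := E.inflation_pushout j g' ⟨_, _, _, hj⟩
    obtain ⟨q', wq', hq', -⟩ := conflation_pushout hj sq'
    have := epi_of_conflation hc'
    have hcepi : Epi c := ⟨fun u v huv => sq'.hom_ext huv (by
      rw [← cancel_epi g', ← Category.assoc, ← Category.assoc, ← sq'.w, Category.assoc,
        Category.assoc, huv])⟩
    have hLX : E.conflation (ShortComplex.mk (f' ≫ j) c
        (by rw [Category.assoc, sq'.w, reassoc_of% w', zero_comp])) := by
      refine Inflation.conflation_of_cokernel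
        (E.inflation_comp f' j ⟨_, _, _, hc'⟩ ⟨_, _, _, hj⟩) fun T k hk => ?_
      obtain ⟨l, hl⟩ := exists_desc_of_conflation hc' (j ≫ k) (by
        rw [← Category.assoc, hk])
      exact ⟨sq'.desc k l hl.symm, by simp⟩
    exact ⟨Q, N', j', q', wq', hq', dimLE_succ hLX hX hL, hN'⟩

/-- An object `M` with `Ext¹(M, H) = 0` for all `H ∈ 𝒲 ∩ ((𝒞 ∩ 𝒲)_n)^⊥` has cofibrant
dimension at most `n`. -/
lemma IsHereditaryHoveyTriple.dimLE_of_ext1Zero (hM : E.IsHereditaryHoveyTriple 𝒞 𝒲 ℱ)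
    (hinj : E.EnoughInj) {n : ℕ} {M : A}
    (h : ∀ H : A, (𝒲 ⊓ E.rightPerp (E.dimLE (𝒞 ⊓ 𝒲) n)) H → E.Ext1Zero M H) :
    E.dimLE 𝒞 n M := by
  have hX := hM.trivCof_fib.toIsCotorsionPair
  have hC := hM.cof_trivFib.toIsCotorsionPair
  induction n generalizing M with
  | zero =>
    refine dimLE_of_mem 0 (hC.left_mem fun H hH => h H ⟨hH.1, fun X hX' => ?_⟩)
    exact hX.ext1Zero (hX.dimLE_zero_iff.1 hX') hH.2
  | succ n ih =>
    obtain ⟨K, C, f, g, w, hc, hCC, -⟩ := hM.cof_trivFib.exists_left M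
    refine dimLE_succ hc hCC (ih fun H hH => ?_)
    obtain ⟨I, i, hI, H', q, wq, hq⟩ := hinj H
    -- Injectives lie in the right class 𝒲 ∩ ℱ; thickness then puts the cosyzygy H' in 𝒲.
    have hIW : 𝒲 I := (hC.right_mem fun _ _ => ext1Zero_of_isInjective hI).1
    have hH' : E.Ext1Zero M H' := h H' ⟨hM.thick.mem₃ _ hq hH.1 hIW,
      hX.rightPerp_dimLE_succ hM.hereditary_trivCof_fib hq hI hH.2⟩
    refine ext1Zero_of_lift hq (ext1Zero_of_isInjective hI) fun a => ?_
    obtain ⟨b, hb⟩ := hH'.exists_extend hc a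
    obtain ⟨d, hd⟩ := (hC.ext1Zero hCC ⟨hH.1, hX.rightPerp_dimLE_le n hH.2⟩).exists_lift hq b
    exact ⟨f ≫ d, by rw [Category.assoc, hd, hb]⟩

end Hovey

end ExactStructure

/-! ### The cycle of implications. -/

open ExactStructure in
theorem theorem3p4 {A : Type u} [Category.{v} A] [Preadditive A] [HasFiniteBiproducts A]
    (E : ExactStructure A) (hWIC : WeaklyIdempotentComplete A)
    (hproj : E.EnoughProj) (hinj : E.EnoughInj)
    (𝒞 𝒲 ℱ : ObjectProperty A) (hM : E.IsHereditaryHoveyTriple 𝒞 𝒲 ℱ)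
    (hext : E.IsLeftExtendable (𝒞 ⊓ 𝒲) ℱ) (n : ℕ) (M : A) :
    List.TFAE [
      E.dimLE 𝒞 n M,
      ∃ (K G : A) (f : K ⟶ G) (g : G ⟶ M) (w : f ≫ g = 0),
        E.conflation (ShortComplex.mk f g w) ∧ 𝒞 G ∧ E.dimLEPred (𝒞 ⊓ 𝒲) n K ∧
          ∀ Y : A, E.rightPerp (E.dimLE (𝒞 ⊓ 𝒲) n) Y →
            ExactStructure.HomExact (ShortComplex.mk f g w) Y,
      ∀ H : A, (𝒲 ⊓ E.rightPerp (E.dimLE (𝒞 ⊓ 𝒲) n)) H → E.Ext1Zero M H,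
      ∃ (L N : A) (f : M ⟶ L) (g : L ⟶ N) (w : f ≫ g = 0),
        E.conflation (ShortComplex.mk f g w) ∧ E.dimLE (𝒞 ⊓ 𝒲) n L ∧ 𝒞 N] := by
  have hX := hM.trivCof_fib.toIsCotorsionPair
  have hC := hM.cof_trivFib.toIsCotorsionPair
  tfae_have 1 → 4 := by
    intro h
    obtain ⟨m, hm, h⟩ := dimLE_iff.1 h
    obtain ⟨L, N, f, g, w, hc, hL, hN⟩ := hM.exists_conflation_of_hasResolution hinj h
    exact ⟨L, N, f, g, w, hc, dimLE_mono hm hL, hN⟩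
  tfae_have 4 → 2 := by
    rintro ⟨L, N, i, p, wi, hi, hL, hN⟩
    obtain ⟨K, X, f, g, w, hc, hXX, hK⟩ := hX.exists_conflation_of_dimLE hL
    obtain ⟨G, b, g', sq, -⟩ := E.deflation_pullback g i ⟨_, _, _, hc⟩
    obtain ⟨f', w', hc', hf'⟩ := conflation_pullback hc sq
    have := mono_of_conflation hi
    have hb : Mono b := ⟨fun u v huv => sq.hom_ext huv (by
      rw [← cancel_mono i, Category.assoc, Category.assoc, ← sq.w, ← Category.assoc,
        ← Category.assoc, huv])⟩
    -- G, the preimage of M in X, is the kernel of X ↠ L ↠ N, a deflation between cofibrant objects.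
    have hGX : E.conflation (ShortComplex.mk b (g ≫ p)
        (by rw [← Category.assoc, sq.w, Category.assoc, wi, comp_zero])) := by
      refine Deflation.conflation_of_kernel
        (E.deflation_comp g p ⟨_, _, _, hc⟩ ⟨_, _, _, hi⟩) fun T k hk => ?_
      obtain ⟨l, hl⟩ := exists_lift_of_conflation hi (k ≫ g) (by rw [Category.assoc, hk])
      exact ⟨sq.lift k l hl.symm, by simp⟩
    refine ⟨K, G, f', g', w', hc', hM.hereditary_cof_trivFib.kernel_mem _ hGX hXX.1 hN, hK,
      fun Y hY => homExact_of_extend hc' fun a => ?_⟩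
    obtain ⟨d, hd⟩ := Ext1Zero.exists_extend (hY L hL) hc a
    exact ⟨b ≫ d, by rw [← Category.assoc, hf', hd]⟩
  tfae_have 2 → 3 := by
    rintro ⟨K, G, f, g, w, hc, hG, -, hY⟩ H hH
    exact ext1Zero_of_extend hc (hC.ext1Zero hG ⟨hH.1, hX.rightPerp_dimLE_le n hH.2⟩)
      (hY H hH.2).2.2
  tfae_have 3 → 1 := hM.dimLE_of_ext1Zero hinj
  tfae_finish
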